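/- Let $\Omega\subset\mathbb{R}^2$ be a non-empty connected open set (not necessarily bounded) whose boundary is Lipschitz, i.e. near each of its boundary points, after a rigid motion, $\Omega$ is exactly the region above the graph of a Lipschitz function $\gamma:\mathbb{R}\to\mathbb{R}$. Let $\Gamma_D\subset\partial\Omega$ be a relatively closed subset of positive surface measure (one-dimensional Hausdorff measure) that has finitely many connected components and at least one interior point relative to $\partial\Omega$. Let $u=(u_1,u_2)\in [H^1(\Omega)]^2$ have trace zero almost everywhere on $\Gamma_D$. Here the trace of $f\in H^1(\Omega)$ is the limit in $L^2_{\mathrm{loc}}(\partial\Omega)$ (which is $L^2(\partial\Omega)$ if $\Omega$ is bounded) of $\varphi_n|_{\partial\Omega}$, for $\varphi_n\in C_c^\infty(\mathbb{R}^2)$ with $\varphi_n\to f$ in $H^1(\Omega)$. Then $u$ satisfies the Cauchy–Riemann equations $$-\partial_{x}u_1+\partial_{y}u_2=0,\qquad \partial_{y}u_1+\partial_{x}u_2=0$$ (with weak partial derivatives) almost everywhere in $\Omega$ if and only if $u=0$ almost everywhere in $\Omega$. -/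

import Mathlib

open MeasureTheory Set Filter Topology
open scoped NNReal ENNReal ContDiff

noncomputable section

namespace ClampedCR

/-- The Euclidean plane `ℝ²`. -/
abbrev Plane : Type := EuclideanSpace ℝ (Fin 2)

/-- The classical partial derivative `∂ᵢ φ` of a (differentiable) scalar function. -/
def partialDeriv (i : Fin 2) (φ : Plane → ℝ) (x : Plane) : ℝ :=
  fderiv ℝ φ x (EuclideanSpace.single i 1)

/-- `Ω` lies, near each of its boundary points and after a rigid motion of the plane, exactly
above the graph of a Lipschitz function. -/
def HasLipschitzBoundary (Ω : Set Plane) : Prop :=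
  ∀ z ∈ frontier Ω, ∃ r : ℝ, 0 < r ∧ ∃ (e : Plane ≃ᵃⁱ[ℝ] Plane) (K : ℝ≥0) (γ : ℝ → ℝ),
    LipschitzWith K γ ∧ ∀ x ∈ Metric.ball z r, (x ∈ Ω ↔ γ (e x 0) < e x 1)

/-- `g` is a weak `i`-th partial derivative of `f` on the open set `Ω`. -/
def HasWeakPartialDeriv (Ω : Set Plane) (i : Fin 2) (f g : Plane → ℝ) : Prop :=
  LocallyIntegrableOn f Ω volume ∧ LocallyIntegrableOn g Ω volume ∧
    ∀ φ : Plane → ℝ, ContDiff ℝ ∞ φ → HasCompactSupport φ → tsupport φ ⊆ Ω →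
      ∫ x in Ω, f x * partialDeriv i φ x = -∫ x in Ω, g x * φ x

open Classical in
/-- The weak partial derivative `∂ᵢ f` on `Ω`. It is determined up to null sets where it exists,
and is set to be `0` where it does not. -/
def weakPartialDeriv (Ω : Set Plane) (i : Fin 2) (f : Plane → ℝ) : Plane → ℝ :=
  if h : ∃ g, HasWeakPartialDeriv Ω i f g then h.choose else 0

/-- The Sobolev space `H¹(Ω)`: `f ∈ L²(Ω)` with weak partial derivatives in `L²(Ω)`. -/
def MemH1 (Ω : Set Plane) (f : Plane → ℝ) : Prop :=
  MemLp f 2 (volume.restrict Ω) ∧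
    ∀ i, ∃ g, HasWeakPartialDeriv Ω i f g ∧ MemLp g 2 (volume.restrict Ω)

/-- The surface (arc length) measure on the boundary of `Ω`. -/
def surfaceMeasure (Ω : Set Plane) : Measure Plane :=
  (Measure.hausdorffMeasure 1).restrict (frontier Ω)

/-- `g` is the boundary trace of `f ∈ H¹(Ω)`. The trace operator is the continuous extension to
`H¹(Ω)` of the restriction `φ ↦ φ|_{∂Ω}` of functions `φ ∈ C_c^∞(ℝ²)`: they converge to `f` in
`H¹(Ω)` and their boundary values converge to `g` in `L²_loc(∂Ω)`
(which is `L²(∂Ω)` when `Ω` is bounded). -/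
def HasTrace (Ω : Set Plane) (f g : Plane → ℝ) : Prop :=
  MemH1 Ω f ∧ AEStronglyMeasurable g (surfaceMeasure Ω) ∧
    ∃ φ : ℕ → Plane → ℝ,
      (∀ n, ContDiff ℝ ∞ (φ n) ∧ HasCompactSupport (φ n)) ∧
      Tendsto (fun n => eLpNorm (φ n - f) 2 (volume.restrict Ω)) atTop (𝓝 0) ∧
      (∀ i, Tendsto (fun n => eLpNorm (partialDeriv i (φ n) - weakPartialDeriv Ω i f) 2
        (volume.restrict Ω)) atTop (𝓝 0)) ∧
      ∀ K : Set Plane, IsCompact K →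
        Tendsto (fun n => eLpNorm (φ n - g) 2 ((surfaceMeasure Ω).restrict K)) atTop (𝓝 0)

/-- The hypotheses on the clamped part `ΓD` of the boundary: a relatively closed subset of `∂Ω`
(hence measurable) of positive surface measure, with finitely many connected components, and with
at least one interior point relative to `∂Ω`. -/
structure IsClampedPart (Ω ΓD : Set Plane) : Prop where
  subset_frontier : ΓD ⊆ frontier Ω
  isClosed : IsClosed ΓD
  measure_pos : 0 < surfaceMeasure Ω ΓD
  finite_components : Finite (ConnectedComponents ΓD)
  exists_interior : ∃ z ∈ ΓD, ∃ r : ℝ, 0 < r ∧ Metric.ball z r ∩ frontier Ω ⊆ ΓD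

/-- The space of vector fields `u ∈ H¹(Ω)²` whose trace vanishes almost everywhere on `ΓD`. -/
def MemH1Clamped (Ω ΓD : Set Plane) (u : Plane → Plane) : Prop :=
  ∀ j : Fin 2, MemH1 Ω (fun x => u x j) ∧
    ∃ g, HasTrace Ω (fun x => u x j) g ∧ ∀ᵐ x ∂(surfaceMeasure Ω).restrict ΓD, g x = 0

/-- The Cauchy-Riemann operator `(-∂₁u₁ + ∂₂u₂, ∂₂u₁ + ∂₁u₂)`, with weak partial derivatives. -/
def cauchyRiemann (Ω : Set Plane) (u : Plane → Plane) (x : Plane) : Plane :=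
  !₂[-weakPartialDeriv Ω 0 (fun y => u y 0) x + weakPartialDeriv Ω 1 (fun y => u y 1) x,
    weakPartialDeriv Ω 1 (fun y => u y 0) x + weakPartialDeriv Ω 0 (fun y => u y 1) x]

end ClampedCR

end

/-!
# Rigidity of clamped solutions of the Cauchy–Riemann equations

The two equations say that `u₁ + i u₂` is weakly holomorphic in `Ω`. Choose a ball `B` around a
relative interior point of `ΓD` so small that `Ω ∩ B` is the part of `B` above a Lipschitz graph and
the trace of `u` vanishes on `B ∩ ∂Ω`. Then the extension of `u` by zero is weakly holomorphic in
all of `B`: for a test function `ψ` supported in `B`, integrating `∂ᵢ(uⱼ ψ)` over `Ω` leaves no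
boundary term (`HasTrace.integral_mul_partialDeriv`). So the extension is weakly holomorphic near
each point of the connected open set `Ω ∪ B`, and it vanishes in the part of `B` below the graph,
which contains a ball. Unique continuation (`ae_eq_zero_of_isPreconnected`) gives `u = 0`.

The boundary term is controlled through the Green-type inequality `enorm_integral_fderiv_le`: for
a smooth compactly supported `F`, the integral of a directional derivative of `F` over the region
above the graph is at most a constant times the integral of `|F|` over the graph. It follows from
integration by parts against the Lipschitz cut-off `max 0 (min 1 (d / ε))`, where `d` is the height
above the graph, as `ε → 0`; no differentiation of the graph is needed. Applied to `φₙ ψ`, with `φₙ`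
the smooth functions that define the trace, the right-hand side tends to zero.

Unique continuation is reduced to holomorphic functions by mollification: the mollified functions
satisfy the Cauchy–Riemann equations classically, so the identity theorem applies to them.

Conversely, weak derivatives are unique up to null sets, so those of `0` vanish
(`MemH1.weakPartialDeriv_ae_eq_zero`).
-/

noncomputable section

namespace ClampedCR

/-! ### Unique continuation for weak solutions of the Cauchy–Riemann equations -/

/-- `a + i b` is weakly holomorphic on `U`: the Cauchy–Riemann equations `∂₀a = ∂₁b` and
`∂₁a = -∂₀b` hold in the sense of distributions on `U`. The functions `a` and `b` are defined on the
whole plane, so that they can be mollified; their values outside `U` play no role. -/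
def WeakCauchyRiemannOn (U : Set Plane) (a b : Plane → ℝ) : Prop :=
  ∀ ψ : Plane → ℝ, ContDiff ℝ ∞ ψ → HasCompactSupport ψ → tsupport ψ ⊆ U →
    ∫ x, a x * partialDeriv 0 ψ x = ∫ x, b x * partialDeriv 1 ψ x ∧
    ∫ x, a x * partialDeriv 1 ψ x = -∫ x, b x * partialDeriv 0 ψ x

lemma WeakCauchyRiemannOn.mono {U V : Set Plane} {a b : Plane → ℝ}
    (h : WeakCauchyRiemannOn V a b) (hUV : U ⊆ V) : WeakCauchyRiemannOn U a b :=
  fun ψ h1 h2 h3 => h ψ h1 h2 (h3.trans hUV)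

/-- The partial derivative of a mollification, as an integral against the derivative of the test
function `φ (x - ·)` (whence the sign). -/
lemma partialDeriv_convolution {φ a : Plane → ℝ} (hφ : ContDiff ℝ ∞ φ)
    (hc : HasCompactSupport φ) (ha : LocallyIntegrable a volume) (i : Fin 2) (x : Plane) :
    partialDeriv i (convolution φ a (ContinuousLinearMap.lsmul ℝ ℝ) volume) x
      = -∫ t, a t * partialDeriv i (fun s => φ (x - s)) t := by
  have h1 : ContDiff ℝ 1 φ := hφ.of_le (by norm_cast)
  have h := hc.hasFDerivAt_convolution_left (ContinuousLinearMap.lsmul ℝ ℝ) h1 ha x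
  rw [partialDeriv, h.fderiv, convolution_eq_swap, ContinuousLinearMap.integral_apply,
    ← integral_neg]
  · refine integral_congr_ae (.of_forall fun t => ?_)
    have hd : HasFDerivAt (fun s => φ (x - s)) (-(fderiv ℝ φ (x - t))) t := by
      have := ((h1.differentiable one_ne_zero (x - t)).hasFDerivAt).comp t
        ((hasFDerivAt_id t).const_sub x)
      exact this.congr_fderiv (by ext v; simp)
    simp only [partialDeriv, hd.fderiv]
    simp [ContinuousLinearMap.precompL_apply, mul_comm]
  · have := (hc.fderiv ℝ).convolutionExists_left
      ((ContinuousLinearMap.lsmul ℝ ℝ).precompL Plane) (h1.continuous_fderiv one_ne_zero) ha x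
    exact this.integrable_swap

lemma differentiable_convolution {φ a : Plane → ℝ} (hφ : ContDiff ℝ ∞ φ)
    (hc : HasCompactSupport φ) (ha : LocallyIntegrable a volume) :
    Differentiable ℝ (convolution φ a (ContinuousLinearMap.lsmul ℝ ℝ) volume) := fun x =>
  (hc.hasFDerivAt_convolution_left (ContinuousLinearMap.lsmul ℝ ℝ)
    (hφ.of_le (by norm_cast)) ha x).differentiableAt

/-- The identity theorem for `A + i B`, with the Cauchy–Riemann equations written for real
functions on the plane. -/
lemma eqOn_zero_of_cauchyRiemann {A B : Plane → ℝ} {U : Set Plane} (hU : IsOpen U)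
    (hUc : IsPreconnected U) (hA : Differentiable ℝ A) (hB : Differentiable ℝ B)
    (h1 : ∀ x ∈ U, partialDeriv 0 A x = partialDeriv 1 B x)
    (h2 : ∀ x ∈ U, partialDeriv 1 A x = -partialDeriv 0 B x)
    {y : Plane} (hy : y ∈ U) (hAy : ∀ᶠ x in 𝓝 y, A x = 0) (hBy : ∀ᶠ x in 𝓝 y, B x = 0) :
    ∀ x ∈ U, A x = 0 ∧ B x = 0 := by
  let L := Complex.orthonormalBasisOneI.repr
  have hL1 : L 1 = EuclideanSpace.single 0 1 := by
    have := Complex.orthonormalBasisOneI.repr_self 0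
    simpa using this
  have hLI : L Complex.I = EuclideanSpace.single 1 1 := by
    have := Complex.orthonormalBasisOneI.repr_self 1
    simpa using this
  let G : ℂ → ℂ := fun z => (A (L z) : ℂ) + (B (L z) : ℂ) * Complex.I
  have hcont : Continuous L := L.continuous
  have hV : IsOpen (L ⁻¹' U) := hU.preimage hcont
  have hVc : IsPreconnected (L ⁻¹' U) :=
    hUc.preimage_of_isOpenMap L.injective L.toHomeomorph.isOpenMap (by
      intro x _; exact L.surjective x)
  have hG : DifferentiableOn ℂ G (L ⁻¹' U) := by
    intro z hz
    refine DifferentiableAt.differentiableWithinAt ?_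
    have hLd : HasFDerivAt L (L.toContinuousLinearEquiv : ℂ →L[ℝ] Plane) z :=
      L.toContinuousLinearEquiv.hasFDerivAt
    have hA' := ((hA (L z)).hasFDerivAt.comp z hLd)
    have hB' := ((hB (L z)).hasFDerivAt.comp z hLd)
    have hG' : HasFDerivAt G _ z :=
      ((Complex.ofRealCLM.hasFDerivAt).comp z hA').add
        (((Complex.ofRealCLM.hasFDerivAt).comp z hB').mul_const Complex.I)
    rw [differentiableAt_complex_iff_differentiableAt_real]
    refine ⟨hG'.differentiableAt, ?_⟩
    rw [hG'.fderiv]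
    have e1 := h1 _ hz
    have e2 := h2 _ hz
    simp only [partialDeriv, ← hL1, ← hLI] at e1 e2
    apply Complex.ext <;> simp [e1, e2]
  have hGa := hG.analyticOnNhd hV
  have hz0 : L.symm y ∈ L ⁻¹' U := by simpa using hy
  have ht : Tendsto L (𝓝 (L.symm y)) (𝓝 y) := by
    have := hcont.tendsto (L.symm y)
    simpa using this
  have hev : G =ᶠ[𝓝 (L.symm y)] 0 := by
    filter_upwards [ht.eventually hAy, ht.eventually hBy] with z ha hb
    simp [G, ha, hb]
  have := hGa.eqOn_zero_of_preconnected_of_eventuallyEq_zero hVc hz0 hev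
  intro x hx
  have hx' : L.symm x ∈ L ⁻¹' U := by simpa using hx
  have e := this hx'
  simp only [G, LinearIsometryEquiv.apply_symm_apply, Pi.zero_apply] at e
  exact ⟨by simpa using congrArg Complex.re e, by simpa using congrArg Complex.im e⟩

/-- Local unique continuation: a weak solution on `ball x r` that vanishes near one point of
`ball x (r / 2)` vanishes almost everywhere on `ball x (r / 2)`. Its mollifications are holomorphic
on the smaller ball and vanish near the point, hence vanish identically, and they converge to it
almost everywhere. -/
lemma WeakCauchyRiemannOn.ae_eq_zero_of_ball {a b : Plane → ℝ} (ha : LocallyIntegrable a volume)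
    (hb : LocallyIntegrable b volume) {x y : Plane} {r δ : ℝ}
    (h : WeakCauchyRiemannOn (Metric.ball x r) a b) (hδ : 0 < δ)
    (hy : y ∈ Metric.ball x (r / 2))
    (h0 : ∀ᵐ t, t ∈ Metric.ball y δ → a t = 0 ∧ b t = 0) :
    ∀ᵐ t, t ∈ Metric.ball x (r / 2) → a t = 0 ∧ b t = 0 := by
  have hr : 0 < r / 2 := Metric.pos_of_mem_ball hy
  -- bump functions supported in radius at most `m` keep the mollification at points of
  -- `ball x (r / 2)` inside `ball x r`, and at points of `ball y (δ / 2)` inside `ball y δ`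
  set m := min (r / 2) (δ / 2)
  have hmpos : 0 < m := lt_min hr (by positivity)
  have hpos : ∀ n : ℕ, 0 < m / (n + 1) := fun n => by positivity
  let φ : ℕ → ContDiffBump (0 : Plane) := fun n =>
    ⟨m / (n + 1) / 2, m / (n + 1), half_pos (hpos n), half_lt_self (hpos n)⟩
  have hφ : Tendsto (fun n => (φ n).rOut) atTop (𝓝 0) :=
    tendsto_const_div_atTop_nhds_zero_nat m |>.comp (tendsto_add_atTop_nat 1) |>.congr
      (fun n => by simp [φ])
  have hφ2 : ∀ᶠ n in atTop, (φ n).rOut ≤ 2 * (φ n).rIn := .of_forall fun n => by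
    simp only [φ]; linarith
  have hle : ∀ n, (φ n).rOut ≤ m := fun n => by
    simp only [φ]
    exact div_le_self hmpos.le (by linarith [(Nat.cast_nonneg n : (0:ℝ) ≤ n)])
  have key : ∀ n, ∀ s ∈ Metric.ball x (r / 2),
      convolution ((φ n).normed volume) a (ContinuousLinearMap.lsmul ℝ ℝ) volume s = 0 ∧
      convolution ((φ n).normed volume) b (ContinuousLinearMap.lsmul ℝ ℝ) volume s = 0 := by
    intro n
    have hsm : ContDiff ℝ ∞ ((φ n).normed volume) := (φ n).contDiff_normed
    have hcs : HasCompactSupport ((φ n).normed volume) := (φ n).hasCompactSupport_normed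
    have htest : ∀ s ∈ Metric.ball x (r / 2),
        ContDiff ℝ ∞ (fun t => (φ n).normed volume (s - t)) ∧
        HasCompactSupport (fun t => (φ n).normed volume (s - t)) ∧
        tsupport (fun t => (φ n).normed volume (s - t)) ⊆ Metric.ball x r := by
      intro s hs
      have hts : tsupport (fun t => (φ n).normed volume (s - t)) ⊆
          Metric.closedBall s (φ n).rOut := by
        refine closure_minimal (fun t ht => ?_) Metric.isClosed_closedBall
        have : s - t ∈ Function.support ((φ n).normed volume) := ht
        rw [(φ n).support_normed_eq] at this
        rw [mem_ball_zero_iff] at this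
        rw [Metric.mem_closedBall, dist_comm, dist_eq_norm]
        exact this.le
      refine ⟨hsm.comp (contDiff_const.sub contDiff_id),
        HasCompactSupport.of_support_subset_isCompact (isCompact_closedBall s (φ n).rOut)
          ((subset_tsupport _).trans hts), hts.trans fun t ht => ?_⟩
      rw [Metric.mem_ball] at hs ⊢
      rw [Metric.mem_closedBall] at ht
      have := dist_triangle t s x
      have := (hle n).trans (min_le_left _ _)
      linarith
    have hvan : ∀ c : Plane → ℝ, (∀ᵐ t, t ∈ Metric.ball y δ → c t = 0) →
        ∀ᶠ s in 𝓝 y, convolution ((φ n).normed volume) c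
          (ContinuousLinearMap.lsmul ℝ ℝ) volume s = 0 := by
      intro c hc
      filter_upwards [Metric.ball_mem_nhds y (half_pos hδ)] with s hs
      rw [convolution_eq_swap]
      refine integral_eq_zero_of_ae ?_
      filter_upwards [hc] with t ht
      by_cases hst : s - t ∈ Function.support ((φ n).normed volume)
      · rw [(φ n).support_normed_eq, mem_ball_zero_iff] at hst
        have : t ∈ Metric.ball y δ := by
          rw [Metric.mem_ball] at hs ⊢
          have h3 := dist_triangle t s y
          rw [dist_comm t s, dist_eq_norm s t] at h3
          have := (hle n).trans (min_le_right _ _)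
          linarith
        simp [ht this]
      · rw [Function.notMem_support] at hst
        simp [hst]
    refine eqOn_zero_of_cauchyRiemann Metric.isOpen_ball
      (convex_ball x (r / 2)).isPreconnected (differentiable_convolution hsm hcs ha)
      (differentiable_convolution hsm hcs hb) ?_ ?_ hy
      (hvan a (h0.mono fun t ht h => (ht h).1)) (hvan b (h0.mono fun t ht h => (ht h).2))
    · intro s hs
      obtain ⟨t1, t2, t3⟩ := htest s hs
      rw [partialDeriv_convolution hsm hcs ha, partialDeriv_convolution hsm hcs hb,
        (h _ t1 t2 t3).1]
    · intro s hs
      obtain ⟨t1, t2, t3⟩ := htest s hs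
      rw [partialDeriv_convolution hsm hcs ha, partialDeriv_convolution hsm hcs hb,
        (h _ t1 t2 t3).2]
  filter_upwards [ContDiffBump.ae_convolution_tendsto_right_of_locallyIntegrable hφ hφ2 ha,
    ContDiffBump.ae_convolution_tendsto_right_of_locallyIntegrable hφ hφ2 hb] with t hta htb ht
  exact ⟨tendsto_nhds_unique hta (tendsto_const_nhds.congr fun n => (key n t ht).1.symm),
    tendsto_nhds_unique htb (tendsto_const_nhds.congr fun n => (key n t ht).2.symm)⟩

/-- Unique continuation along a connected set: the points near which the solution vanishes almost
everywhere form a relatively clopen set. -/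
lemma ae_eq_zero_of_isPreconnected {W : Set Plane} {a b : Plane → ℝ}
    (hW : IsPreconnected W) (ha : LocallyIntegrable a volume)
    (hb : LocallyIntegrable b volume)
    (h : ∀ x ∈ W, ∃ r > 0, WeakCauchyRiemannOn (Metric.ball x r) a b)
    {y : Plane} (hy : y ∈ W) {δ : ℝ} (hδ : 0 < δ)
    (h0 : ∀ᵐ t, t ∈ Metric.ball y δ → a t = 0 ∧ b t = 0) :
    ∀ᵐ t, t ∈ W → a t = 0 ∧ b t = 0 := by
  let Z : Set Plane :=
    {x | ∃ δ > 0, ∀ᵐ t, t ∈ Metric.ball x δ → a t = 0 ∧ b t = 0}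
  have hZ : IsOpen Z := by
    rw [Metric.isOpen_iff]
    rintro x ⟨δ, hδ, hx⟩
    refine ⟨δ / 2, half_pos hδ, fun s hs => ⟨δ / 2, half_pos hδ, hx.mono fun t ht hts => ht ?_⟩⟩
    rw [Metric.mem_ball] at *
    linarith [dist_triangle t s x]
  have hWZ : W ⊆ Z := by
    refine hW.subset_of_closure_inter_subset hZ ⟨y, hy, δ, hδ, h0⟩ ?_
    rintro x ⟨hx, hxW⟩
    obtain ⟨r, hr, hcr⟩ := h x hxW
    obtain ⟨s, ⟨δ', hδ', hs⟩, hsx⟩ := Metric.mem_closure_iff.1 hx (r / 2) (half_pos hr)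
    exact ⟨r / 2, half_pos hr, hcr.ae_eq_zero_of_ball ha hb hδ'
      (by rwa [Metric.mem_ball, dist_comm]) hs⟩
  have hnull : volume ({t | ¬ (a t = 0 ∧ b t = 0)} ∩ W) = 0 := by
    refine measure_null_of_locally_null _ ?_
    rintro x ⟨-, hx⟩
    obtain ⟨δ', hδ', hs⟩ := hWZ hx
    refine ⟨{t | ¬ (a t = 0 ∧ b t = 0)} ∩ Metric.ball x δ', inter_mem
      (mem_of_superset self_mem_nhdsWithin inter_subset_left)
      (mem_nhdsWithin_of_mem_nhds (Metric.ball_mem_nhds x hδ')), ?_⟩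
    rw [ae_iff] at hs
    refine measure_mono_null (fun t ht => ?_) hs
    exact fun h => ht.1 (h ht.2)
  rw [ae_iff]
  convert hnull using 2
  ext t; simp only [mem_ofPred_eq, mem_inter_iff]; tauto

/-! ### Integrals over a Lipschitz graph and the region above it -/

/-- The signed height of `x` above the graph of `γ`, measured vertically in the coordinates given
by the rigid motion `e`. -/
def graphHeight (e : Plane ≃ᵃⁱ[ℝ] Plane) (γ : ℝ → ℝ) (x : Plane) : ℝ := e x 1 - γ (e x 0)

/-- The point at height `τ` above the point of the graph of `γ` with abscissa `s`, in the
coordinates given by the rigid motion `e`; in particular `graphPoint e γ s 0` is on the graph. -/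
def graphPoint (e : Plane ≃ᵃⁱ[ℝ] Plane) (γ : ℝ → ℝ) (s τ : ℝ) : Plane := e.symm !₂[s, γ s + τ]

section Graph

variable (e : Plane ≃ᵃⁱ[ℝ] Plane) {K : ℝ≥0} {γ : ℝ → ℝ}

lemma apply_graphPoint_zero (s τ : ℝ) : e (graphPoint e γ s τ) 0 = s := by
  simp [graphPoint]

lemma graphHeight_graphPoint (s τ : ℝ) : graphHeight e γ (graphPoint e γ s τ) = τ := by
  simp [graphHeight, graphPoint]

lemma graphPoint_graphHeight (x : Plane) : graphPoint e γ (e x 0) (graphHeight e γ x) = x := by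
  rw [graphPoint, graphHeight, AffineIsometryEquiv.symm_apply_eq]
  ext i; fin_cases i <;> simp

lemma continuous_graphPoint (hγ : Continuous γ) :
    Continuous fun p : ℝ × ℝ => graphPoint e γ p.1 p.2 := by
  refine e.symm.continuous.comp ((PiLp.continuous_toLp 2 _).comp (continuous_pi fun i => ?_))
  fin_cases i
  · exact continuous_fst
  · exact (hγ.comp continuous_fst).add continuous_snd

/-- The coordinates `(s, τ)` come from a shear followed by a rigid motion. -/
lemma measurePreserving_graphPoint (hγ : Continuous γ) :
    MeasurePreserving (fun p : ℝ × ℝ => graphPoint e γ p.1 p.2) volume volume := by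
  have h1 : MeasurePreserving (fun p : ℝ × ℝ => (p.1, γ p.1 + p.2)) volume volume := by
    refine MeasurePreserving.skew_product (MeasurePreserving.id volume) (g := fun s t => γ s + t)
      ?_ (.of_forall fun s => map_add_left_eq_self volume (γ s))
    exact ((hγ.comp continuous_fst).add continuous_snd).measurable
  have h2 : MeasurePreserving (fun p : ℝ × ℝ => (!₂[p.1, p.2] : Plane)) volume volume :=
    (PiLp.volume_preserving_toLp (Fin 2)).comp (volume_preserving_finTwoArrow ℝ).symm
  have h3 : MeasurePreserving (fun y : Plane => e.symm y) volume volume := by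
    have h := (measurePreserving_add_right volume (e.symm 0)).comp
      (e.symm.linearIsometryEquiv.measurePreserving)
    refine (funext fun y => ?_ : (fun y => e.symm y) = _) ▸ h
    simpa using e.symm.map_vadd 0 y
  exact h3.comp (h2.comp h1)

lemma lipschitzWith_apply (i : Fin 2) : LipschitzWith 1 fun x => e x i := by
  refine LipschitzWith.of_dist_le_mul fun x y => ?_
  rw [NNReal.coe_one, one_mul, ← e.dist_map x y, dist_eq_norm, dist_eq_norm, ← PiLp.sub_apply]
  exact PiLp.norm_apply_le _ i

lemma lipschitzWith_graphHeight (hγ : LipschitzWith K γ) :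
    LipschitzWith (1 + K) (graphHeight e γ) := by
  have h := (lipschitzWith_apply e 1).sub (hγ.comp (lipschitzWith_apply e 0))
  rw [mul_one] at h
  exact h

lemma lipschitzWith_graphPoint (hγ : LipschitzWith K γ) :
    LipschitzWith (1 + K) fun s => graphPoint e γ s 0 := by
  refine LipschitzWith.of_dist_le_mul fun s t => ?_
  rw [graphPoint, graphPoint, e.symm.dist_map, EuclideanSpace.dist_eq]
  have h := hγ.dist_le_mul s t
  refine Real.sqrt_le_iff.2 ⟨by positivity, ?_⟩
  simp only [Fin.sum_univ_two, Matrix.cons_val_zero, Matrix.cons_val_one, add_zero,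
    NNReal.coe_add, NNReal.coe_one]
  have : dist (γ s) (γ t) ^ 2 ≤ (K * dist s t) ^ 2 := by gcongr
  nlinarith [mul_nonneg K.coe_nonneg (sq_nonneg (dist s t))]

/-- Integration by parts against the cut-off `max 0 (min 1 (d / ε))`, whose derivative is bounded by
a multiple of `1 / ε` and vanishes off the strip `0 ≤ d ≤ ε`. -/
lemma enorm_integral_cutoff_le {d : Plane → ℝ} {C : ℝ≥0} (hd : LipschitzWith C d) {F : Plane → ℝ}
    (hF : ContDiff ℝ ∞ F) (hc : HasCompactSupport F) (v : Plane) {ε : ℝ≥0} (hε : 0 < ε) :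
    ‖∫ x, fderiv ℝ F x v * max 0 (min 1 (d x / ε))‖ₑ ≤
      (C / ε * ‖v‖₊ : ℝ≥0) * ∫⁻ x in {x | d x ∈ Icc 0 (ε : ℝ)}, ‖F x‖ₑ := by
  set η : Plane → ℝ := fun x => max 0 (min 1 (d x / ε)) with hη
  have hε' : (0 : ℝ) < ε := hε
  have hηL : LipschitzWith (C / ε) η := by
    refine LipschitzWith.const_max (LipschitzWith.const_min (LipschitzWith.of_dist_le_mul
      fun x y => ?_) 1) 0
    have := hd.dist_le_mul x y
    rw [Real.dist_eq] at *
    rw [← sub_div, abs_div, abs_of_pos hε', NNReal.coe_div, div_mul_eq_mul_div]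
    gcongr
  obtain ⟨D, hFL⟩ := hF.lipschitzWith_of_hasCompactSupport hc (by simp)
  have hparts := hηL.integral_lineDeriv_mul_eq (μ := volume) hFL hc v
  have hFd : ∀ x, lineDeriv ℝ F x (-v) = -fderiv ℝ F x v := fun x => by
    rw [((hF.differentiable (by simp)) x).lineDeriv_eq_fderiv, map_neg]
  have : ∫ x, fderiv ℝ F x v * η x = -∫ x, lineDeriv ℝ η x v * F x := by
    rw [hparts, ← integral_neg]
    simp [hFd]
  rw [this, enorm_neg]
  refine (enorm_integral_le_lintegral_enorm _).trans ?_
  have hmeas : MeasurableSet {x | d x ∈ Icc 0 (ε : ℝ)} :=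
    hd.continuous.measurable measurableSet_Icc
  rw [← lintegral_const_mul' _ _ ENNReal.coe_ne_top, ← lintegral_indicator hmeas]
  refine lintegral_mono fun x => ?_
  by_cases hx : d x ∈ Icc 0 (ε : ℝ)
  · rw [indicator_of_mem (show x ∈ {x | d x ∈ Icc 0 (ε : ℝ)} from hx), enorm_mul]
    gcongr
    rw [enorm_eq_nnnorm, ENNReal.coe_le_coe, ← NNReal.coe_le_coe]
    exact norm_lineDeriv_le_of_lipschitz ℝ hηL
  · suffices h : lineDeriv ℝ η x v = 0 by simp [h]
    -- the cut-off is locally constant away from the strip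
    have hopen : ∀ᶠ y in 𝓝 x, η y = η x := by
      rw [mem_Icc, not_and_or, not_le, not_le] at hx
      rcases hx with hx | hx
      · have hz : ∀ y, d y < 0 → η y = 0 := fun y hy =>
          max_eq_left ((min_le_right _ _).trans (div_neg_of_neg_of_pos hy hε').le)
        filter_upwards [hd.continuous.continuousAt.eventually_lt continuousAt_const hx] with y hy
        rw [hz y hy, hz x hx]
      · have hz : ∀ y, ε < d y → η y = 1 := fun y hy => by
          simp only [hη]
          rw [min_eq_left ((one_le_div hε').2 hy.le), max_eq_right zero_le_one]
        filter_upwards [continuousAt_const.eventually_lt hd.continuous.continuousAt hx] with y hy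
        rw [hz y hy, hz x hx]
    have heq : η =ᶠ[𝓝 x] fun _ => η x := hopen
    rw [heq.lineDeriv_eq]
    simp [lineDeriv]

/-- The integral of `|F|` over a strip of width `ε` above the graph is `ε` times its integral over
the graph, with respect to the abscissa, up to an error of order `ε ^ 2`. -/
lemma lintegral_strip_le {γ : ℝ → ℝ} (hγ : Continuous γ) {F : Plane → ℝ} {D R : ℝ≥0}
    (hF : LipschitzWith D F) (hR : ∀ x, F x ≠ 0 → |e x 0| ≤ R) (ε : ℝ≥0) :
    ∫⁻ x in {x | graphHeight e γ x ∈ Icc 0 (ε : ℝ)}, ‖F x‖ₑ ≤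
      ε * ((∫⁻ s, ‖F (graphPoint e γ s 0)‖ₑ) + D * ε * (2 * R)) := by
  have hcont := continuous_graphPoint e hγ
  have hd : Continuous (graphHeight e γ) := by
    unfold graphHeight
    exact (lipschitzWith_apply e 1).continuous.sub (hγ.comp (lipschitzWith_apply e 0).continuous)
  have hmp := measurePreserving_graphPoint e hγ
  have hmeas : MeasurableSet {x | graphHeight e γ x ∈ Icc 0 (ε : ℝ)} :=
    hd.measurable measurableSet_Icc
  rw [← hmp.setLIntegral_comp_preimage hmeas
    (f := fun x => ‖F x‖ₑ) hF.continuous.enorm.measurable]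
  have hpre : (fun p : ℝ × ℝ => graphPoint e γ p.1 p.2) ⁻¹'
      {x | graphHeight e γ x ∈ Icc 0 (ε : ℝ)} = univ ×ˢ Icc 0 (ε : ℝ) := by
    ext p; simp [graphHeight_graphPoint]
  have hm0 : Measurable fun s => ‖F (graphPoint e γ s 0)‖ₑ :=
    (hF.continuous.comp (hcont.comp (continuous_id.prodMk continuous_const))).enorm.measurable
  rw [hpre, Measure.volume_eq_prod, ← Measure.prod_restrict, Measure.restrict_univ,
    lintegral_prod (fun p : ℝ × ℝ => ‖F (graphPoint e γ p.1 p.2)‖ₑ)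
      (hF.continuous.comp hcont).enorm.measurable.aemeasurable]
  calc ∫⁻ s, ∫⁻ τ in Icc 0 (ε : ℝ), ‖F (graphPoint e γ s τ)‖ₑ
      ≤ ∫⁻ s, ε * (‖F (graphPoint e γ s 0)‖ₑ +
          (Icc (-(R : ℝ)) R).indicator (fun _ => (D * ε : ℝ≥0∞)) s) := by
        refine lintegral_mono fun s => ?_
        calc ∫⁻ τ in Icc 0 (ε : ℝ), ‖F (graphPoint e γ s τ)‖ₑ
            ≤ ∫⁻ τ in Icc 0 (ε : ℝ), (‖F (graphPoint e γ s 0)‖ₑ +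
          (Icc (-(R : ℝ)) R).indicator (fun _ => (D * ε : ℝ≥0∞)) s) := by
              refine setLIntegral_mono' measurableSet_Icc fun τ hτ => ?_
              by_cases h0 : F (graphPoint e γ s τ) = 0
              · simp [h0]
              have hs : s ∈ Icc (-(R : ℝ)) R := by
                have := hR _ h0
                rwa [apply_graphPoint_zero, abs_le] at this
              rw [indicator_of_mem hs]
              have h1 : edist (F (graphPoint e γ s τ)) (F (graphPoint e γ s 0)) ≤ D * ε := by
                refine (hF _ _).trans ?_
                gcongr
                rw [graphPoint, graphPoint, e.symm.edist_map, edist_dist, EuclideanSpace.dist_eq]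
                simp only [Fin.sum_univ_two, Matrix.cons_val_zero,
                  Matrix.cons_val_one, dist_self, dist_add_left, Real.dist_0_eq_abs]
                rw [zero_pow two_ne_zero, zero_add, Real.sqrt_sq (abs_nonneg τ),
                  abs_of_nonneg hτ.1]
                exact ENNReal.ofReal_le_of_le_toReal (by simpa using hτ.2)
              calc ‖F (graphPoint e γ s τ)‖ₑ = ‖F (graphPoint e γ s 0) +
                    (F (graphPoint e γ s τ) - F (graphPoint e γ s 0))‖ₑ := by simp
                _ ≤ _ := enorm_add_le _ _
                _ ≤ _ := by gcongr; rwa [← edist_eq_enorm_sub]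
          _ = _ := by
              rw [setLIntegral_const, Real.volume_Icc, sub_zero, ENNReal.ofReal_coe_nnreal,
                mul_comm]
    _ = _ := by
        rw [lintegral_const_mul' _ _ ENNReal.coe_ne_top,
          lintegral_add_left hm0, lintegral_indicator measurableSet_Icc, setLIntegral_const,
          Real.volume_Icc, sub_neg_eq_add, ← two_mul, ENNReal.ofReal_mul zero_le_two,
          ENNReal.ofReal_coe_nnreal, ENNReal.ofReal_ofNat]

/-- A Green-type inequality above a Lipschitz graph. -/
lemma enorm_integral_fderiv_le (hγ : LipschitzWith K γ) {F : Plane → ℝ}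
    (hF : ContDiff ℝ ∞ F) (hc : HasCompactSupport F) (v : Plane) :
    ‖∫ x in {x | 0 < graphHeight e γ x}, fderiv ℝ F x v‖ₑ ≤
      ((1 + K) * ‖v‖₊ : ℝ≥0) * ∫⁻ s, ‖F (graphPoint e γ s 0)‖ₑ := by
  have hd := lipschitzWith_graphHeight e hγ
  obtain ⟨D, hFL⟩ := hF.lipschitzWith_of_hasCompactSupport hc (by simp)
  obtain ⟨R, hR⟩ : ∃ R : ℝ≥0, ∀ x, F x ≠ 0 → |e x 0| ≤ R := by
    obtain ⟨R, hR⟩ := hc.isCompact.exists_bound_of_continuousOn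
      (lipschitzWith_apply e 0).continuous.continuousOn
    exact ⟨R.toNNReal, fun x hx =>
      (hR x (subset_tsupport _ hx)).trans (Real.le_coe_toNNReal R)⟩
  have hdc : Continuous fun x => fderiv ℝ F x v :=
    (hF.continuous_fderiv (by simp)).clm_apply continuous_const
  have hdi : Integrable fun x => fderiv ℝ F x v :=
    hdc.integrable_of_hasCompactSupport (hc.fderiv_apply ℝ v)
  let ε : ℕ → ℝ≥0 := fun n => 1 / (n + 1)
  have hεpos : ∀ n, 0 < ε n := fun n => by positivity
  have hε : Tendsto ε atTop (𝓝 0) := tendsto_one_div_add_atTop_nhds_zero_nat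
  set S := {x | 0 < graphHeight e γ x} with hS
  have hSm : MeasurableSet S := hd.continuous.measurable measurableSet_Ioi
  have hlim : Tendsto (fun n => ∫ x, fderiv ℝ F x v * max 0 (min 1 (graphHeight e γ x / ε n)))
      atTop (𝓝 (∫ x in S, fderiv ℝ F x v)) := by
    rw [← integral_indicator hSm]
    refine tendsto_integral_of_dominated_convergence (fun x => ‖fderiv ℝ F x v‖)
      (fun n => ?_) hdi.norm (fun n => .of_forall fun x => ?_) (.of_forall fun x => ?_)
    · exact (hdc.mul (continuous_const.max (continuous_const.min
        (hd.continuous.div_const _)))).aestronglyMeasurable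
    · rw [norm_mul, Real.norm_of_nonneg (le_max_left 0 _)]
      exact mul_le_of_le_one_right (norm_nonneg _) (max_le zero_le_one (min_le_left _ _))
    · by_cases hx : x ∈ S
      · rw [indicator_of_mem hx]
        refine tendsto_const_nhds.congr' ?_
        filter_upwards [hε.eventually (gt_mem_nhds (show (0 : ℝ≥0) <
          (graphHeight e γ x).toNNReal from Real.toNNReal_pos.2 hx))] with n hn
        have hn' : (ε n : ℝ) < graphHeight e γ x := Real.lt_toNNReal_iff_coe_lt.1 hn
        have hp : (0 : ℝ) < ε n := hεpos n
        rw [min_eq_left ((one_le_div hp).2 hn'.le), max_eq_right zero_le_one, mul_one]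
      · rw [indicator_of_notMem hx]
        refine tendsto_const_nhds.congr fun n => ?_
        have hx' : graphHeight e γ x ≤ 0 := not_lt.1 hx
        rw [max_eq_left ((min_le_right _ _).trans
          (div_nonpos_of_nonpos_of_nonneg hx' (ε n).coe_nonneg)), mul_zero]
  set I := ∫⁻ s, ‖F (graphPoint e γ s 0)‖ₑ with hI
  have hbound : ∀ n, ‖∫ x, fderiv ℝ F x v * max 0 (min 1 (graphHeight e γ x / ε n))‖ₑ ≤
      ((1 + K) * ‖v‖₊ : ℝ≥0) * (I + D * ε n * (2 * R)) := by
    intro n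
    refine (enorm_integral_cutoff_le hd hF hc v (hεpos n)).trans ?_
    refine (mul_le_mul_right (lintegral_strip_le e hγ.continuous hFL hR (ε n)) _).trans ?_
    rw [← mul_assoc, ← ENNReal.coe_mul, mul_right_comm ((1 + K) / ε n),
      div_mul_cancel₀ _ (hεpos n).ne']
  refine le_of_tendsto_of_tendsto' hlim.enorm ?_ hbound
  have h1 : Tendsto (fun n => (D : ℝ≥0∞) * ε n * (2 * R)) atTop (𝓝 0) := by
    have h2 : Tendsto (fun n => D * ε n * (2 * R)) atTop (𝓝 0) := by
      simpa using (hε.const_mul D).mul_const (2 * R)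
    simpa using ENNReal.tendsto_coe.2 h2
  have h3 := ENNReal.Tendsto.const_mul (a := (((1 + K) * ‖v‖₊ : ℝ≥0) : ℝ≥0∞))
    (h1.const_add I) (Or.inr ENNReal.coe_ne_top)
  rwa [add_zero] at h3

/-- Integrals with respect to the abscissa are at most integrals with respect to arc length, as the
projection of the graph to the axis does not increase distances. -/
lemma lintegral_graphPoint_le (hγ : LipschitzWith K γ) {G : Plane → ℝ} (hG : Continuous G) :
    ∫⁻ s, ‖G (graphPoint e γ s 0)‖ₑ ≤
      ∫⁻ x in {x | graphHeight e γ x = 0}, ‖G x‖ₑ ∂(Measure.hausdorffMeasure 1) := by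
  set Γ := {x | graphHeight e γ x = 0} with hΓ
  have hΓm : MeasurableSet Γ :=
    (lipschitzWith_graphHeight e hγ).continuous.measurable (measurableSet_singleton 0)
  have hq := lipschitzWith_apply e 0
  have hp := (lipschitzWith_graphPoint e hγ).continuous
  have hle : (volume : Measure ℝ) ≤
      Measure.map (fun x => e x 0) ((Measure.hausdorffMeasure 1).restrict Γ) := by
    refine Measure.le_iff.2 fun A hA => ?_
    rw [Measure.map_apply hq.continuous.measurable hA,
      Measure.restrict_apply (hq.continuous.measurable hA), ← hausdorffMeasure_real]
    have := hq.hausdorffMeasure_image_le zero_le_one ((fun x => e x 0) ⁻¹' A ∩ Γ)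
    simp only [ENNReal.coe_one, ENNReal.one_rpow, one_mul] at this
    refine (measure_mono fun s hs => ?_).trans this
    exact ⟨graphPoint e γ s 0, ⟨by simpa [apply_graphPoint_zero] using hs,
      graphHeight_graphPoint e s 0⟩, apply_graphPoint_zero e s 0⟩
  calc ∫⁻ s, ‖G (graphPoint e γ s 0)‖ₑ
      ≤ ∫⁻ s, ‖G (graphPoint e γ s 0)‖ₑ
          ∂Measure.map (fun x => e x 0) ((Measure.hausdorffMeasure 1).restrict Γ) :=
        lintegral_mono' hle le_rfl
    _ = ∫⁻ x in Γ, ‖G (graphPoint e γ (e x 0) 0)‖ₑ ∂(Measure.hausdorffMeasure 1) :=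
        lintegral_map (hG.comp hp).enorm.measurable hq.continuous.measurable
    _ = _ := by
        refine setLIntegral_congr_fun hΓm fun x hx => ?_
        have h := graphPoint_graphHeight e (γ := γ) x
        rw [show graphHeight e γ x = 0 from hx] at h
        simp only [h]

lemma hausdorffMeasure_graph_inter_lt_top (hγ : LipschitzWith K γ) {T : Set Plane}
    (hT : IsCompact T) :
    Measure.hausdorffMeasure 1 ({x | graphHeight e γ x = 0} ∩ T) < ⊤ := by
  obtain ⟨R, hR⟩ := hT.exists_bound_of_continuousOn
      (lipschitzWith_apply e 0).continuous.continuousOn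
  have hsub : {x | graphHeight e γ x = 0} ∩ T ⊆ (fun s => graphPoint e γ s 0) '' Icc (-R) R := by
    rintro x ⟨hx, hxT⟩
    refine ⟨e x 0, abs_le.1 (hR x hxT), ?_⟩
    have h := graphPoint_graphHeight e (γ := γ) x
    rwa [show graphHeight e γ x = 0 from hx] at h
  refine (measure_mono hsub).trans_lt
    (((lipschitzWith_graphPoint e hγ).hausdorffMeasure_image_le zero_le_one _).trans_lt ?_)
  rw [hausdorffMeasure_real]
  exact ENNReal.mul_lt_top (ENNReal.rpow_lt_top_of_nonneg zero_le_one ENNReal.coe_ne_top)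
    measure_Icc_lt_top

section Domain

variable {Ω : Set Plane} {z : Plane} {r : ℝ}

lemma mem_frontier_of_graphHeight_eq_zero (hγ : LipschitzWith K γ) (hΩ : IsOpen Ω)
    (h : ∀ x ∈ Metric.ball z r, (x ∈ Ω ↔ 0 < graphHeight e γ x)) {x : Plane}
    (hx : x ∈ Metric.ball z r) (hx0 : graphHeight e γ x = 0) : x ∈ frontier Ω := by
  rw [hΩ.frontier_eq]
  refine ⟨?_, fun hxΩ => ((h x hx).1 hxΩ).ne' hx0⟩
  have hc : Tendsto (fun τ => graphPoint e γ (e x 0) τ) (𝓝[>] 0) (𝓝 x) := by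
    have h1 : Continuous fun τ => graphPoint e γ (e x 0) τ :=
      (continuous_graphPoint e hγ.continuous).comp (continuous_const.prodMk continuous_id)
    have h2 := h1.tendsto 0
    rw [← hx0, graphPoint_graphHeight, hx0] at h2
    exact h2.mono_left nhdsWithin_le_nhds
  refine mem_closure_of_tendsto hc ?_
  filter_upwards [hc.eventually (Metric.isOpen_ball.mem_nhds hx), self_mem_nhdsWithin] with τ h1 h2
  exact (h _ h1).2 (by rwa [graphHeight_graphPoint])

/-- Points slightly below the graph lie in the exterior of `Ω`. -/
lemma exists_ball_disjoint (hγ : LipschitzWith K γ) (hΩ : IsOpen Ω)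
    (h : ∀ x ∈ Metric.ball z r, (x ∈ Ω ↔ 0 < graphHeight e γ x)) (hr : 0 < r)
    (hz : z ∈ frontier Ω) :
    ∃ y ∈ Metric.ball z r, ∃ δ > 0, Disjoint (Metric.ball y δ) Ω := by
  have hz' : graphHeight e γ z ≤ 0 := by
    rw [hΩ.frontier_eq] at hz
    exact not_lt.1 fun h0 => hz.2 ((h z (Metric.mem_ball_self hr)).2 h0)
  have hd := (lipschitzWith_graphHeight e hγ).continuous
  have hc : Tendsto (fun τ => graphPoint e γ (e z 0) (graphHeight e γ z - τ)) (𝓝[>] 0) (𝓝 z) := by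
    have h1 : Continuous fun τ => graphPoint e γ (e z 0) (graphHeight e γ z - τ) :=
      (continuous_graphPoint e hγ.continuous).comp
        (continuous_const.prodMk (continuous_const.sub continuous_id))
    have h2 := h1.tendsto 0
    rw [sub_zero, graphPoint_graphHeight] at h2
    exact h2.mono_left nhdsWithin_le_nhds
  obtain ⟨τ, h1, h2⟩ := ((hc.eventually (Metric.isOpen_ball.mem_nhds
    (Metric.mem_ball_self hr))).and self_mem_nhdsWithin).exists
  have hτ : (0 : ℝ) < τ := h2
  set y := graphPoint e γ (e z 0) (graphHeight e γ z - τ) with hy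
  have hopen : IsOpen (Metric.ball z r ∩ {x | graphHeight e γ x < 0}) :=
    Metric.isOpen_ball.inter (isOpen_lt hd continuous_const)
  have hyd : graphHeight e γ y < 0 := by
    rw [hy, graphHeight_graphPoint]; linarith
  obtain ⟨δ, hδ, hsub⟩ := Metric.isOpen_iff.1 hopen y ⟨h1, hyd⟩
  refine ⟨y, h1, δ, hδ, Set.disjoint_left.2 fun x hx hxΩ => ?_⟩
  have hx' := hsub hx
  exact lt_asymm ((h x hx'.1).1 hxΩ) hx'.2

end Domain

end Graph

/-! ### Weak partial derivatives -/

/-- Weak partial derivatives are unique up to null sets. -/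
lemma HasWeakPartialDeriv.ae_eq {Ω : Set Plane} (hΩ : IsOpen Ω) {i : Fin 2} {f f' g g' : Plane → ℝ}
    (h : HasWeakPartialDeriv Ω i f g) (h' : HasWeakPartialDeriv Ω i f' g')
    (hf : f =ᵐ[volume.restrict Ω] f') : g =ᵐ[volume.restrict Ω] g' := by
  have key : ∀ᵐ x, x ∈ Ω → g x - g' x = 0 := by
    refine hΩ.ae_eq_zero_of_integral_contDiff_smul_eq_zero (h.2.1.sub h'.2.1) fun φ hφ hc hs => ?_
    have hint : ∀ k : Plane → ℝ, LocallyIntegrableOn k Ω volume →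
        Integrable (fun x => φ x • k x) := fun k hk => by
      refine (integrableOn_iff_integrable_of_support_subset
        ((Function.support_smul_subset_left φ k).trans (subset_tsupport φ))).1 ?_
      exact (hk.integrableOn_compact_subset hs hc.isCompact).continuousOn_smul
        hφ.continuous.continuousOn hc.isCompact
    have hset : ∀ k : Plane → ℝ, ∫ x in Ω, k x * φ x = ∫ x, φ x • k x := fun k => by
      simp only [smul_eq_mul, mul_comm (φ _)]
      refine setIntegral_eq_integral_of_forall_compl_eq_zero fun x hx => ?_
      rw [image_eq_zero_of_notMem_tsupport fun hx' => hx (hs hx'), mul_zero]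
    have e1 := h.2.2 φ hφ hc hs
    have e2 := h'.2.2 φ hφ hc hs
    rw [hset] at e1 e2
    have e3 : ∫ x in Ω, f x * partialDeriv i φ x = ∫ x in Ω, f' x * partialDeriv i φ x :=
      integral_congr_ae (hf.mono fun x hx => by simp only [hx])
    simp only [smul_sub]
    rw [integral_sub (hint g h.2.1) (hint g' h'.2.1)]
    linarith
  rw [EventuallyEq, ae_restrict_iff' hΩ.measurableSet]
  exact key.mono fun x hx hxΩ => sub_eq_zero.1 (hx hxΩ)

lemma MemH1.hasWeakPartialDeriv {Ω : Set Plane} {f : Plane → ℝ} (hf : MemH1 Ω f) (i : Fin 2) :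
    HasWeakPartialDeriv Ω i f (weakPartialDeriv Ω i f) := by
  obtain ⟨g, hg, -⟩ := hf.2 i
  have h : ∃ g, HasWeakPartialDeriv Ω i f g := ⟨g, hg⟩
  rw [weakPartialDeriv, dif_pos h]
  exact h.choose_spec

lemma MemH1.memLp_weakPartialDeriv {Ω : Set Plane} (hΩ : IsOpen Ω) {f : Plane → ℝ}
    (hf : MemH1 Ω f) (i : Fin 2) : MemLp (weakPartialDeriv Ω i f) 2 (volume.restrict Ω) := by
  obtain ⟨g, hg, hg2⟩ := hf.2 i
  exact hg2.ae_eq (hg.ae_eq hΩ (hf.hasWeakPartialDeriv i) .rfl)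

lemma hasWeakPartialDeriv_zero (Ω : Set Plane) (i : Fin 2) :
    HasWeakPartialDeriv Ω i (fun _ => 0) (fun _ => 0) :=
  ⟨(locallyIntegrable_const 0).locallyIntegrableOn Ω,
    (locallyIntegrable_const 0).locallyIntegrableOn Ω, by simp⟩

lemma MemH1.weakPartialDeriv_ae_eq_zero {Ω : Set Plane} (hΩ : IsOpen Ω) {f : Plane → ℝ}
    (hf : MemH1 Ω f) (h0 : ∀ᵐ x ∂volume.restrict Ω, f x = 0) (i : Fin 2) :
    ∀ᵐ x ∂volume.restrict Ω, weakPartialDeriv Ω i f x = 0 :=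
  (hf.hasWeakPartialDeriv i).ae_eq hΩ (hasWeakPartialDeriv_zero Ω i) h0

lemma tendsto_integral_mul_of_eLpNorm {α : Type*} [MeasurableSpace α] {μ : Measure α}
    {f : ℕ → α → ℝ} {g h : α → ℝ} (hf : ∀ n, MemLp (f n) 2 μ) (hg : MemLp g 2 μ)
    (hh : MemLp h 2 μ) (hlim : Tendsto (fun n => eLpNorm (f n - g) 2 μ) atTop (𝓝 0)) :
    Tendsto (fun n => ∫ x, f n x * h x ∂μ) atTop (𝓝 (∫ x, g x * h x ∂μ)) := by
  refine tendsto_integral_of_L1 _ (hg.integrable_mul hh).aestronglyMeasurable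
    (.of_forall fun n => (hf n).integrable_mul hh) ?_
  have hb : ∀ n, ∫⁻ x, ‖f n x * h x - g x * h x‖ₑ ∂μ ≤ eLpNorm (f n - g) 2 μ * eLpNorm h 2 μ := by
    intro n
    have := eLpNorm_smul_le_mul_eLpNorm (p := 2) (q := 2) (r := 1) hh.1 ((hf n).sub hg).1
    rw [eLpNorm_one_eq_lintegral_enorm] at this
    simpa only [Pi.smul_apply', Pi.sub_apply, smul_eq_mul, sub_mul] using this
  refine tendsto_of_tendsto_of_tendsto_of_le_of_le tendsto_const_nhds ?_ (fun _ => zero_le) hb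
  simpa using ENNReal.Tendsto.mul_const hlim (Or.inr hh.eLpNorm_ne_top)

/-! ### Functions with vanishing trace -/

lemma contDiff_partialDeriv {φ : Plane → ℝ} (hφ : ContDiff ℝ ∞ φ) (i : Fin 2) :
    ContDiff ℝ ∞ (partialDeriv i φ) :=
  (hφ.fderiv_right (m := ∞) (by simp)).clm_apply contDiff_const

lemma hasCompactSupport_partialDeriv {φ : Plane → ℝ} (hφ : HasCompactSupport φ) (i : Fin 2) :
    HasCompactSupport (partialDeriv i φ) :=
  hφ.fderiv_apply ℝ _

/-- Integration by parts for a function whose trace vanishes on `∂Ω ∩ ball z r`: the test function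
`ψ` need only be supported in the ball, not in `Ω`. -/
lemma HasTrace.integral_mul_partialDeriv {Ω ΓD : Set Plane} (hΩ : IsOpen Ω) {f g : Plane → ℝ}
    (hfg : HasTrace Ω f g) (hg : ∀ᵐ x ∂(surfaceMeasure Ω).restrict ΓD, g x = 0)
    {z : Plane} {r : ℝ} (hΓ : Metric.ball z r ∩ frontier Ω ⊆ ΓD)
    (e : Plane ≃ᵃⁱ[ℝ] Plane) {K : ℝ≥0} {γ : ℝ → ℝ} (hγ : LipschitzWith K γ)
    (hΩe : ∀ x ∈ Metric.ball z r, (x ∈ Ω ↔ 0 < graphHeight e γ x)) (i : Fin 2)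
    {ψ : Plane → ℝ} (hψ : ContDiff ℝ ∞ ψ) (hc : HasCompactSupport ψ)
    (hs : tsupport ψ ⊆ Metric.ball z r) :
    ∫ x in Ω, f x * partialDeriv i ψ x = -∫ x in Ω, weakPartialDeriv Ω i f x * ψ x := by
  obtain ⟨hH1, -, φ, hφ, hφ0, hφ1, hφg⟩ := hfg
  have hL2 : ∀ {k : Plane → ℝ}, ContDiff ℝ ∞ k → HasCompactSupport k →
      MemLp k 2 (volume.restrict Ω) := fun hk hkc =>
    hk.continuous.memLp_of_hasCompactSupport hkc
  have hdψ := contDiff_partialDeriv hψ i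
  have hdψc := hasCompactSupport_partialDeriv hc i
  have hdφ := fun n => contDiff_partialDeriv (hφ n).1 i
  have hdφc := fun n => hasCompactSupport_partialDeriv (hφ n).2 i
  have lim1 := tendsto_integral_mul_of_eLpNorm (fun n => hL2 (hφ n).1 (hφ n).2) hH1.1
    (hL2 hdψ hdψc) hφ0
  have lim2 := tendsto_integral_mul_of_eLpNorm (fun n => hL2 (hdφ n) (hdφc n))
    (hH1.memLp_weakPartialDeriv hΩ i) (hL2 hψ hc) (hφ1 i)
  have lim := lim1.add lim2
  set S := {x | 0 < graphHeight e γ x} with hS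
  have hd := (lipschitzWith_graphHeight e hγ).continuous
  have hSm : MeasurableSet S := hd.measurable measurableSet_Ioi
  -- the product rule turns the sum into an integral over the epigraph
  have hsum : ∀ n, (∫ x in Ω, φ n x * partialDeriv i ψ x) + ∫ x in Ω, partialDeriv i (φ n) x * ψ x =
      ∫ x in S, fderiv ℝ (fun y => φ n y * ψ y) x (EuclideanSpace.single i 1) := by
    intro n
    have hpr : ∀ x, fderiv ℝ (fun y => φ n y * ψ y) x (EuclideanSpace.single i 1) =
        φ n x * partialDeriv i ψ x + partialDeriv i (φ n) x * ψ x := fun x => by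
      rw [fderiv_fun_mul (((hφ n).1.differentiable (by simp)) x) ((hψ.differentiable (by simp)) x)]
      simp [partialDeriv, mul_comm]
    have hi1 : Integrable (fun x => φ n x * partialDeriv i ψ x) (volume.restrict Ω) :=
      (hL2 (hφ n).1 (hφ n).2).integrable_mul (hL2 hdψ hdψc)
    have hi2 : Integrable (fun x => partialDeriv i (φ n) x * ψ x) (volume.restrict Ω) :=
      (hL2 (hdφ n) (hdφc n)).integrable_mul (hL2 hψ hc)
    rw [← integral_add hi1 hi2, ← integral_indicator hΩ.measurableSet,
      ← integral_indicator hSm]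
    congr 1
    ext x
    by_cases hx : x ∈ tsupport ψ
    · have : x ∈ Ω ↔ x ∈ S := hΩe x (hs hx)
      by_cases hxΩ : x ∈ Ω
      · rw [indicator_of_mem hxΩ, indicator_of_mem (this.1 hxΩ), hpr]
      · rw [indicator_of_notMem hxΩ, indicator_of_notMem (fun h => hxΩ (this.2 h))]
    · have h1 : ψ x = 0 := image_eq_zero_of_notMem_tsupport hx
      have h2 : partialDeriv i ψ x = 0 := by
        rw [partialDeriv, image_eq_zero_of_notMem_tsupport
          (fun h => hx (tsupport_fderiv_subset ℝ h))]
        simp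
      simp [indicator_apply, hpr, h1, h2]
  -- arc length on the part of the graph that meets the support of `ψ`; it lies in `ΓD`, where the
  -- trace is zero, so the `φ n` tend to zero there
  set T := tsupport ψ with hT
  set Γ := {x | graphHeight e γ x = 0} with hΓdef
  have hΓm : MeasurableSet Γ := hd.measurable (measurableSet_singleton 0)
  have hTm : MeasurableSet T := (isClosed_tsupport ψ).measurableSet
  set ν : Measure Plane := (Measure.hausdorffMeasure 1).restrict (Γ ∩ T) with hν
  have hνfin : ν univ < ⊤ := by
    rw [hν, Measure.restrict_apply_univ]
    exact hausdorffMeasure_graph_inter_lt_top e hγ hc.isCompact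
  have hsubF : Γ ∩ T ⊆ frontier Ω := fun x hx =>
    mem_frontier_of_graphHeight_eq_zero e hγ hΩ hΩe (hs hx.2) hx.1
  have hsubD : Γ ∩ T ⊆ ΓD := fun x hx => hΓ ⟨hs hx.2, hsubF hx⟩
  have hν1 : ν ≤ (surfaceMeasure Ω).restrict T := by
    rw [surfaceMeasure, Measure.restrict_restrict hTm, hν]
    exact Measure.restrict_mono (subset_inter inter_subset_right hsubF) le_rfl
  have hν2 : ν ≤ (surfaceMeasure Ω).restrict ΓD := by
    have h : ν = (surfaceMeasure Ω).restrict (Γ ∩ T) := by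
      rw [surfaceMeasure, Measure.restrict_restrict (hΓm.inter hTm), hν,
        inter_eq_self_of_subset_left hsubF]
    rw [h]
    exact Measure.restrict_mono hsubD le_rfl
  have hgν : ∀ᵐ x ∂ν, g x = 0 := hg.filter_mono (ae_mono hν2)
  have hφν : Tendsto (fun n => eLpNorm (φ n) 1 ν) atTop (𝓝 0) := by
    have hb : ∀ n, eLpNorm (φ n) 1 ν ≤
        eLpNorm (φ n - g) 2 ((surfaceMeasure Ω).restrict T) * ν univ ^ (1 / 2 : ℝ) := by
      intro n
      refine (eLpNorm_le_eLpNorm_mul_rpow_measure_univ one_le_two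
        (hφ n).1.continuous.aestronglyMeasurable).trans ?_
      have h1 : eLpNorm (φ n) 2 ν = eLpNorm (φ n - g) 2 ν :=
        eLpNorm_congr_ae (hgν.mono fun x hx => by simp [hx])
      rw [h1]
      refine mul_le_mul' (eLpNorm_mono_measure _ hν1) (le_of_eq ?_)
      norm_num
    refine tendsto_of_tendsto_of_tendsto_of_le_of_le tendsto_const_nhds ?_ (fun _ => zero_le) hb
    simpa using ENNReal.Tendsto.mul_const (hφg T hc.isCompact)
      (Or.inr (ENNReal.rpow_lt_top_of_nonneg (by norm_num) hνfin.ne).ne)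
  obtain ⟨M, hM⟩ := hψ.continuous.bounded_above_of_compact_support hc
  have hbound : ∀ n, ‖∫ x in S, fderiv ℝ (fun y => φ n y * ψ y) x (EuclideanSpace.single i 1)‖ₑ ≤
      ((1 + K) * ‖(EuclideanSpace.single i 1 : Plane)‖₊ : ℝ≥0) *
        (ENNReal.ofReal M * eLpNorm (φ n) 1 ν) := by
    intro n
    refine (enorm_integral_fderiv_le e hγ ((hφ n).1.mul hψ) (hc.mul_left) _).trans ?_
    gcongr
    refine (lintegral_graphPoint_le e hγ ((hφ n).1.continuous.mul hψ.continuous)).trans ?_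
    rw [eLpNorm_one_eq_lintegral_enorm, ← lintegral_const_mul' _ _ ENNReal.ofReal_ne_top, hν,
      ← lintegral_indicator hΓm, ← lintegral_indicator (hΓm.inter hTm)]
    refine lintegral_mono fun x => ?_
    by_cases hxT : x ∈ T
    · by_cases hxΓ : x ∈ Γ
      · rw [indicator_of_mem hxΓ, indicator_of_mem (mem_inter hxΓ hxT), Pi.mul_apply,
          enorm_mul, mul_comm]
        gcongr
        rw [← ofReal_norm]
        exact ENNReal.ofReal_le_ofReal (hM x)
      · simp [indicator_of_notMem hxΓ]
    · have h1 : ψ x = 0 := image_eq_zero_of_notMem_tsupport hxT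
      simp [indicator_apply, h1]
  have hzero : Tendsto (fun n =>
      ∫ x in S, fderiv ℝ (fun y => φ n y * ψ y) x (EuclideanSpace.single i 1)) atTop (𝓝 0) := by
    rw [tendsto_zero_iff_enorm_tendsto_zero]
    refine tendsto_of_tendsto_of_tendsto_of_le_of_le tendsto_const_nhds ?_ (fun _ => zero_le)
      hbound
    have h1 := ENNReal.Tendsto.const_mul (a := ENNReal.ofReal M) hφν (Or.inr ENNReal.ofReal_ne_top)
    have h2 := ENNReal.Tendsto.const_mul
      (a := (((1 + K) * ‖(EuclideanSpace.single i 1 : Plane)‖₊ : ℝ≥0) : ℝ≥0∞)) h1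
      (Or.inr ENNReal.coe_ne_top)
    simpa using h2
  have := tendsto_nhds_unique (lim.congr hsum) hzero
  linarith

/-- If the weak derivatives of `u` on `Ω` pass the integration by parts test for all `ψ` supported
in `V`, then the extension of `u` by zero outside `Ω` is weakly holomorphic on `V`. -/
lemma weakCauchyRiemannOn_indicator {Ω V : Set Plane} (hΩ : IsOpen Ω) {u : Plane → Plane}
    (hCR : ∀ᵐ x ∂volume.restrict Ω, cauchyRiemann Ω u x = 0)
    (hV : ∀ i j : Fin 2, ∀ ψ : Plane → ℝ, ContDiff ℝ ∞ ψ → HasCompactSupport ψ → tsupport ψ ⊆ V →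
      ∫ x in Ω, u x j * partialDeriv i ψ x =
        -∫ x in Ω, weakPartialDeriv Ω i (fun y => u y j) x * ψ x) :
    WeakCauchyRiemannOn V (Ω.indicator fun x => u x 0) (Ω.indicator fun x => u x 1) := by
  intro ψ hψ hc hs
  have hset : ∀ i j : Fin 2, ∫ x, Ω.indicator (fun x => u x j) x * partialDeriv i ψ x =
      -∫ x in Ω, weakPartialDeriv Ω i (fun y => u y j) x * ψ x := fun i j => by
    rw [← hV i j ψ hψ hc hs, ← integral_indicator hΩ.measurableSet]
    congr 1; ext x
    by_cases hx : x ∈ Ω <;> simp [hx]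
  have h0 := hCR.mono fun x hx => congrFun (congrArg WithLp.ofLp hx) 0
  have h1 := hCR.mono fun x hx => congrFun (congrArg WithLp.ofLp hx) 1
  simp only [cauchyRiemann, Matrix.cons_val_zero, Matrix.cons_val_one, PiLp.zero_apply] at h0 h1
  rw [hset, hset, hset, hset, neg_neg]
  constructor
  · refine congrArg Neg.neg (integral_congr_ae (h0.mono fun x hx => ?_))
    beta_reduce
    rw [show weakPartialDeriv Ω 0 (fun y => u y 0) x = weakPartialDeriv Ω 1 (fun y => u y 1) x by
      linarith]
  · rw [← integral_neg]
    refine integral_congr_ae (h1.mono fun x hx => ?_)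
    beta_reduce
    rw [show weakPartialDeriv Ω 1 (fun y => u y 0) x = -weakPartialDeriv Ω 0 (fun y => u y 1) x by
      linarith, neg_mul, neg_neg]

end ClampedCR

end

theorem lemma3p4 (Ω ΓD : Set ClampedCR.Plane) (hΩ : IsOpen Ω) (hconn : IsConnected Ω)
    (hLip : ClampedCR.HasLipschitzBoundary Ω) (hΓD : ClampedCR.IsClampedPart Ω ΓD)
    (u : ClampedCR.Plane → ClampedCR.Plane) (hu : ClampedCR.MemH1Clamped Ω ΓD u) :
    (∀ᵐ x ∂volume.restrict Ω, ClampedCR.cauchyRiemann Ω u x = 0) ↔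
      (∀ᵐ x ∂volume.restrict Ω, u x = 0) := by
  open ClampedCR in
  constructor
  · intro hCR
    obtain ⟨z, hzD, r₁, hr₁, hball⟩ := hΓD.exists_interior
    have hzF := hΓD.subset_frontier hzD
    obtain ⟨r₂, hr₂, e, K, γ, hγ, hgraph⟩ := hLip z hzF
    set r := min r₁ r₂
    have hr : 0 < r := lt_min hr₁ hr₂
    have hΩe : ∀ x ∈ Metric.ball z r, (x ∈ Ω ↔ 0 < graphHeight e γ x) := fun x hx => by
      rw [hgraph x (Metric.ball_subset_ball (min_le_right _ _) hx), graphHeight, sub_pos]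
    have hΓ : Metric.ball z r ∩ frontier Ω ⊆ ΓD :=
      (inter_subset_inter_left _ (Metric.ball_subset_ball (min_le_left _ _))).trans hball
    have hloc : ∀ j : Fin 2, LocallyIntegrable (Ω.indicator fun x => u x j) volume := fun j =>
      ((memLp_indicator_iff_restrict hΩ.measurableSet).2 (hu j).1.1).locallyIntegrable one_le_two
    have hB : WeakCauchyRiemannOn (Metric.ball z r) (Ω.indicator fun x => u x 0)
        (Ω.indicator fun x => u x 1) := by
      refine weakCauchyRiemannOn_indicator hΩ hCR fun i j ψ hψ hc hs => ?_
      obtain ⟨g, hg, hg0⟩ := (hu j).2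
      exact hg.integral_mul_partialDeriv hΩ hg0 hΓ e hγ hΩe i hψ hc hs
    have hO : WeakCauchyRiemannOn Ω (Ω.indicator fun x => u x 0) (Ω.indicator fun x => u x 1) :=
      weakCauchyRiemannOn_indicator hΩ hCR fun i j ψ hψ hc hs =>
        ((hu j).1.hasWeakPartialDeriv i).2.2 ψ hψ hc hs
    -- a ball in the exterior of `Ω`, from which the vanishing of the extension propagates
    obtain ⟨y, hy, δ, hδ, hdisj⟩ := exists_ball_disjoint e hγ hΩ hΩe hr hzF
    have hne : (Ω ∩ Metric.ball z r).Nonempty := by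
      rw [inter_comm]
      exact mem_closure_iff.1 hzF.1 _ Metric.isOpen_ball (Metric.mem_ball_self hr)
    have hW : IsPreconnected (Ω ∪ Metric.ball z r) :=
      hconn.isPreconnected.union' hne (convex_ball z r).isPreconnected
    have key := ae_eq_zero_of_isPreconnected hW (hloc 0) (hloc 1) (fun x hx => by
        rcases hx with hx | hx
        · obtain ⟨ρ, hρ, hsub⟩ := Metric.isOpen_iff.1 hΩ x hx
          exact ⟨ρ, hρ, hO.mono hsub⟩
        · obtain ⟨ρ, hρ, hsub⟩ := Metric.isOpen_iff.1 Metric.isOpen_ball x hx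
          exact ⟨ρ, hρ, hB.mono hsub⟩) (Or.inr hy) hδ (.of_forall fun t ht => by
        have := disjoint_left.1 hdisj ht
        simp [this])
    rw [ae_restrict_iff' hΩ.measurableSet]
    filter_upwards [key] with x hx hxΩ
    have h := hx (Or.inl hxΩ)
    rw [indicator_of_mem hxΩ, indicator_of_mem hxΩ] at h
    ext i
    fin_cases i
    · exact h.1
    · exact h.2
  · intro h0
    have hz : ∀ i j : Fin 2, ∀ᵐ x ∂volume.restrict Ω,
        weakPartialDeriv Ω i (fun y => u y j) x = 0 := fun i j =>
      (hu j).1.weakPartialDeriv_ae_eq_zero hΩ (h0.mono fun x hx => by simp [hx]) i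
    filter_upwards [hz 0 0, hz 0 1, hz 1 0, hz 1 1] with x h1 h2 h3 h4
    ext i
    fin_cases i <;> simp [cauchyRiemann, h1, h2, h3, h4]
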